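/- Let $n\ge 2$ and $\ell\ge 1$ be integers and let $r_1,\dots,r_\ell$ be positive integers. Identify $\mathbb A^n=\mathbb C^n$ with the space of monic complex polynomials $g(x)=x^n+\sum_{i=0}^{n-1}a_ix^i$ via $g\mapsto (a_0,\dots,a_{n-1})$, and let $g^{\circ r}$ denote the $r$-fold composition of $g$ with itself. Let $Z(n,\ell;r_1,\dots,r_\ell)\subset\mathbb A^n$ be the set of all $g$ such that, for every $i$, the polynomial $g^{\circ r_i}(x)-x$ has no multiple roots. If $g_0\in Z(n,\ell;r_1,\dots,r_\ell)$ and $\beta$ is a point of exact period $r=r_i$ of $z\mapsto g_0(z)$, then $\beta$ extends uniquely, for $g$ in a small neighbourhood of $g_0$ in the complex topology, to a holomorphic function $\beta(g)$ of the coefficients of $g$ with $\beta(g_0)=\beta$ and $g^{\circ r}(\beta(g))=\beta(g)$; let $\operatorname{Mult}_{\beta,r}(g)=(g^{\circ r})'(\beta(g))$ and let $\operatorname{grad}(\operatorname{Mult}_{\beta,r})|_{g_0}\in\mathbb C^n$ be the vector of its partial derivatives at $g_0$ with respect to $a_0,\dots,a_{n-1}$. Let $Z^0(n,\ell;r_1,\dots,r_\ell)$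 be the set of all $g\in Z(n,\ell;r_1,\dots,r_\ell)$ such that for every choice of $\beta_1,\dots,\beta_\ell\in\mathbb C$ where $\beta_i$ is a periodic point of $z\mapsto g(z)$ of exact period $r_i$ and the $\beta_i$ belong to pairwise distinct orbits, the $\ell$ vectors $\operatorname{grad}(\operatorname{Mult}_{\beta_1,r_1})|_{g},\dots,\operatorname{grad}(\operatorname{Mult}_{\beta_\ell,r_\ell})|_{g}$ are linearly independent over $\mathbb C$. (If no such choice exists for $g$, the condition holds vacuously.) Then $Z^0(n,\ell;r_1,\dots,r_\ell)$ is a Zariski-open subset of $Z(n,\ell;r_1,\dots,r_\ell)$, and it is a Zariski-open subset of $\mathbb A^n$. -/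

import Mathlib

open scoped Topology ContDiff

noncomputable section

namespace PeriodicMultipliers

/-- The Zariski topology on the affine space `ℂⁿ`: the closed sets are the zero loci of ideals
of `ℂ[a₀, …, aₙ₋₁]`. -/
abbrev zariskiTopology (n : ℕ) : TopologicalSpace (Fin n → ℂ) :=
  TopologicalSpace.ofClosed
    {S | ∃ I : Ideal (MvPolynomial (Fin n) ℂ), S = MvPolynomial.zeroLocus ℂ I}
    ⟨⊤, by simp⟩
    (by
      intro A hA
      have hA' : ∀ S ∈ A, ∃ I : Ideal (MvPolynomial (Fin n) ℂ),
          S = MvPolynomial.zeroLocus ℂ I := fun S hS => hA hS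
      choose! I hI using hA'
      refine ⟨⨆ S ∈ A, I S, ?_⟩
      refine Set.Subset.antisymm (fun x hx => ?_) (fun x hx S hS => ?_)
      · have : (⨆ S ∈ A, I S) ≤ MvPolynomial.vanishingIdeal ℂ {x} := by
          refine iSup₂_le fun S hS p hp => ?_
          have h1 : x ∈ MvPolynomial.zeroLocus ℂ (I S) := hI S hS ▸ hx S hS
          simpa using h1 p hp
        intro p hp
        simpa using this hp
      · rw [hI S hS]
        exact fun p hp => hx p ((le_iSup₂ (f := fun S (_ : S ∈ A) => I S) S hS) hp))
    (by
      rintro _ ⟨I, rfl⟩ _ ⟨J, rfl⟩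
      refine ⟨I * J, Set.Subset.antisymm (fun x hx => ?_) (fun x hx => ?_)⟩
      · rcases hx with hx | hx
        · exact MvPolynomial.zeroLocus_anti_mono (K := ℂ) (Ideal.mul_le_left (I := I) (J := J)) hx
        · exact MvPolynomial.zeroLocus_anti_mono (K := ℂ) (Ideal.mul_le_right (I := I) (J := J)) hx
      · by_contra hcon
        simp only [Set.mem_union, MvPolynomial.mem_zeroLocus_iff, not_or, not_forall] at hcon
        obtain ⟨⟨p, hp, hpx⟩, ⟨q, hq, hqx⟩⟩ := hcon
        have := hx (p * q) (Ideal.mul_mem_mul hp hq)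
        rw [map_mul] at this
        exact (mul_ne_zero hpx hqx) this)

/-- The monic polynomial `xⁿ + ∑ aᵢ xⁱ` with coefficient vector `a ∈ ℂⁿ`. This identifies `ℂⁿ`
with the affine space of monic complex polynomials of degree `n`. -/
def monicPoly {n : ℕ} (a : Fin n → ℂ) : Polynomial ℂ :=
  Polynomial.X ^ n + ∑ i : Fin n, Polynomial.C (a i) * Polynomial.X ^ (i : ℕ)

/-- The `r`-fold composition `g ∘ ⋯ ∘ g` of `g = monicPoly a`, as a polynomial. -/
def iter {n : ℕ} (r : ℕ) (a : Fin n → ℂ) : Polynomial ℂ :=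
  (monicPoly a).comp^[r] Polynomial.X

/-- The map `z ↦ g(z)` for `g = monicPoly a`. -/
def polyMap {n : ℕ} (a : Fin n → ℂ) : ℂ → ℂ := fun z => (monicPoly a).eval z

/-- The set of all monic `g` of degree `n` such that `g^{∘ r}(x) - x` has no multiple roots. -/
def Zr (n r : ℕ) : Set (Fin n → ℂ) :=
  {a | (iter r a - Polynomial.X).roots.Nodup}

/-- The intersection of the sets `Zr n (r i)`. -/
def Z (n ℓ : ℕ) (r : Fin ℓ → ℕ) : Set (Fin n → ℂ) :=
  ⋂ i, Zr n (r i)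

/-- `b` is a holomorphic function defined near `a`, with `b a = β`, such that `b a'` is a root of
`g^{∘ r}(x) - x` for all `g = monicPoly a'` close to `monicPoly a`. -/
structure IsRootBranch {n : ℕ} (r : ℕ) (a : Fin n → ℂ) (β : ℂ) (b : (Fin n → ℂ) → ℂ) :
    Prop where
  analyticAt : AnalyticAt ℂ b a
  apply_self : b a = β
  eventually_root : ∀ᶠ a' in 𝓝 a, (iter r a').eval (b a') = b a'

/-- The locally defined multiplier function `g ↦ (g^{∘ r})'(b(g))` along a branch `b`. -/
def multiplier {n : ℕ} (r : ℕ) (b : (Fin n → ℂ) → ℂ) (a : Fin n → ℂ) : ℂ :=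
  (Polynomial.derivative (iter r a)).eval (b a)

open Classical in
/-- The gradient at `a` (vector of partial derivatives with respect to the coefficients) of the
multiplier function of the periodic point `β`, continued holomorphically near `a`. When `β` is a
simple root of `g^{∘ r}(x) - x`, the branch exists (`exists_isRootBranch`) and its germ is unique
(`IsRootBranch.eventuallyEq`); the value `0` in the other case is a convention. -/
def multiplierGrad {n : ℕ} (r : ℕ) (a : Fin n → ℂ) (β : ℂ) : Fin n → ℂ :=
  if h : ∃ b : (Fin n → ℂ) → ℂ, IsRootBranch r a β b then
    fun i => fderiv ℂ (multiplier r h.choose) a (Pi.single i 1)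
  else 0

/-- The set of all `g` in `Z n ℓ r` such that for every choice of periodic points `β i` of
exact period `r i` in pairwise distinct orbits of `z ↦ g(z)`, the gradients at `g` of the
multipliers are linearly independent. -/
def Z0 (n ℓ : ℕ) (r : Fin ℓ → ℕ) : Set (Fin n → ℂ) :=
  {a | a ∈ Z n ℓ r ∧ ∀ β : Fin ℓ → ℂ,
    (∀ i, Function.minimalPeriod (polyMap a) (β i) = r i) →
    (Pairwise fun i j =>
      Function.periodicOrbit (polyMap a) (β i) ≠ Function.periodicOrbit (polyMap a) (β j)) →
    LinearIndependent ℂ fun i => multiplierGrad (r i) a (β i)}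

/-! ### The branches exist and are unique -/

theorem eval_iter {n : ℕ} (r : ℕ) (a : Fin n → ℂ) (z : ℂ) :
    (iter r a).eval z = (polyMap a)^[r] z := by
  simp only [iter, Polynomial.iterate_comp_eval, Polynomial.eval_X]
  rfl

theorem polyMap_eq {n : ℕ} (a : Fin n → ℂ) (z : ℂ) :
    polyMap a z = z ^ n + ∑ i : Fin n, a i * z ^ (i : ℕ) := by
  simp [polyMap, monicPoly, Polynomial.eval_finsetSum]

theorem contDiff_eval_iter (n r : ℕ) :
    ContDiff ℂ ω fun v : (Fin n → ℂ) × ℂ => (iter r v.1).eval v.2 := by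
  simp only [eval_iter]
  induction r with
  | zero => exact contDiff_snd
  | succ r ih =>
    simp only [Function.iterate_succ_apply', polyMap_eq]
    fun_prop

theorem natDegree_monicPoly {n : ℕ} (a : Fin n → ℂ) : (monicPoly a).natDegree = n := by
  refine Polynomial.natDegree_eq_of_degree_eq_some ?_
  rw [monicPoly, Polynomial.degree_add_eq_left_of_degree_lt, Polynomial.degree_X_pow]
  rw [Polynomial.degree_X_pow]
  refine (Polynomial.degree_sum_le _ _).trans_lt ((Finset.sup_lt_iff (WithBot.bot_lt_coe n)).2 ?_)
  intro i _
  exact (Polynomial.degree_C_mul_X_pow_le _ _).trans_lt (WithBot.coe_lt_coe.2 i.2)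

theorem iter_ne_X {n r : ℕ} (hn : 2 ≤ n) (hr : 1 ≤ r) (a : Fin n → ℂ) :
    iter r a ≠ Polynomial.X := by
  intro h
  have h1 := congrArg Polynomial.natDegree h
  rw [iter, Polynomial.natDegree_iterate_comp, natDegree_monicPoly, Polynomial.natDegree_X,
    mul_one] at h1
  have := Nat.one_lt_pow (by omega : r ≠ 0) (by omega : 1 < n)
  omega

theorem derivative_iter_ne_one {n r : ℕ} {a : Fin n → ℂ} {β : ℂ} (hn : 2 ≤ n) (hr : 1 ≤ r)
    (ha : a ∈ Zr n r) (hβ : (iter r a).eval β = β) :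
    (Polynomial.derivative (iter r a)).eval β ≠ 1 := by
  intro h
  have hne : iter r a - Polynomial.X ≠ 0 := sub_ne_zero.2 (iter_ne_X hn hr a)
  have h1 := (Polynomial.one_lt_rootMultiplicity_iff_isRoot hne (t := β)).2
    ⟨by simp [hβ], by simp [h]⟩
  rw [← Polynomial.count_roots] at h1
  exact absurd (Multiset.nodup_iff_count_le_one.1 ha β) (by omega)

section Branch

variable {n r : ℕ} {a : Fin n → ℂ} {β : ℂ}

theorem isInvertible_aux (h : (Polynomial.derivative (iter r a)).eval β ≠ 1) :
    (fderiv ℂ (fun v : (Fin n → ℂ) × ℂ => (iter r v.1).eval v.2 - v.2) (a, β) ∘L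
      ContinuousLinearMap.inr ℂ (Fin n → ℂ) ℂ).IsInvertible := by
  set c := (Polynomial.derivative (iter r a)).eval β - 1 with hc
  have hc0 : c ≠ 0 := sub_ne_zero.2 h
  have hd : DifferentiableAt ℂ
      (fun v : (Fin n → ℂ) × ℂ => (iter r v.1).eval v.2 - v.2) (a, β) :=
    (((contDiff_eval_iter n r).sub contDiff_snd).differentiable (by simp)) _
  have h1 := hd.hasFDerivAt.comp β (hasFDerivAt_prodMk_right (𝕜 := ℂ) a β)
  have h2 : HasFDerivAt (fun z : ℂ => (iter r a).eval z - z)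
      (ContinuousLinearMap.toSpanSingleton ℂ c) β :=
    (((iter r a).hasDerivAt β).sub (hasDerivAt_id β)).hasFDerivAt
  rw [h1.unique h2]
  refine ⟨ContinuousLinearEquiv.unitsEquivAut ℂ (Units.mk0 c hc0), ?_⟩
  ext
  simp

/-- Existence of the branch at a simple root. -/
theorem exists_isRootBranch (hβ : (iter r a).eval β = β)
    (h : (Polynomial.derivative (iter r a)).eval β ≠ 1) :
    ∃ b : (Fin n → ℂ) → ℂ, IsRootBranch r a β b := by
  have cdf : ContDiffAt ℂ ω
      (fun v : (Fin n → ℂ) × ℂ => (iter r v.1).eval v.2 - v.2) (a, β) :=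
    ((contDiff_eval_iter n r).sub contDiff_snd).contDiffAt
  refine ⟨cdf.implicitFunction (by simp) (isInvertible_aux h), ?_, ?_, ?_⟩
  · exact (cdf.contDiffAt_implicitFunction (by simp) (isInvertible_aux h)).analyticAt
  · exact cdf.implicitFunction_apply_self (by simp) (isInvertible_aux h)
  · filter_upwards [cdf.eventually_apply_implicitFunction (by simp) (isInvertible_aux h)]
      with x hx
    simpa [hβ, sub_eq_zero] using hx

/-- Uniqueness of the germ of the branch at a simple root. -/
theorem IsRootBranch.eventuallyEq {b b' : (Fin n → ℂ) → ℂ}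
    (h : (Polynomial.derivative (iter r a)).eval β ≠ 1)
    (hb : IsRootBranch r a β b) (hb' : IsRootBranch r a β b') : b =ᶠ[𝓝 a] b' := by
  have hβ : (iter r a).eval β = β := by
    have := hb.eventually_root.self_of_nhds
    rwa [hb.apply_self] at this
  have cdf : ContDiffAt ℂ ω
      (fun v : (Fin n → ℂ) × ℂ => (iter r v.1).eval v.2 - v.2) (a, β) :=
    ((contDiff_eval_iter n r).sub contDiff_snd).contDiffAt
  have key : ∀ c : (Fin n → ℂ) → ℂ, IsRootBranch r a β c →
      ∀ᶠ x in 𝓝 a, cdf.implicitFunction (by simp) (isInvertible_aux h) x = c x := by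
    intro c hc
    have ht : Filter.Tendsto (fun x => (x, c x)) (𝓝 a) (𝓝 (a, β)) := by
      have := hc.analyticAt.continuousAt.tendsto
      rw [hc.apply_self] at this
      exact Filter.tendsto_id.prodMk_nhds this
    filter_upwards [ht.eventually (cdf.eventually_apply_eq_iff_implicitFunction (by simp)
      (isInvertible_aux h)), hc.eventually_root] with x hx hx'
    exact hx.1 (by simp [hx', hβ])
  filter_upwards [key b hb, key b' hb'] with x h1 h2
  rw [← h1, h2]

/-- The gradient computed along any branch. -/
theorem IsRootBranch.multiplierGrad_eq {b : (Fin n → ℂ) → ℂ}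
    (h : (Polynomial.derivative (iter r a)).eval β ≠ 1) (hb : IsRootBranch r a β b) :
    multiplierGrad r a β = fun i => fderiv ℂ (multiplier r b) a (Pi.single i 1) := by
  have hex : ∃ b : (Fin n → ℂ) → ℂ, IsRootBranch r a β b := ⟨b, hb⟩
  rw [multiplierGrad, dif_pos hex]
  have he : multiplier r hex.choose =ᶠ[𝓝 a] multiplier r b := by
    filter_upwards [hex.choose_spec.eventuallyEq h hb] with x hx
    simp [multiplier, hx]
  rw [he.fderiv_eq]

end Branch

end PeriodicMultipliers

end

/-! The set `Z` is Zariski open, and inside it the bad locus is the projection to coefficient space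
of a closed set of pairs (a, β). Such projections are closed: each β i is a root of g^{∘ r i}(x) -
x, which is monic over ℂ[a], so the projection is finite (`image_zeroLocus_of_integral`,
`isOpen_compl_projection`). It remains to express badness by polynomial equations in (a, β).

Exact period and distinctness of orbits are inequalities, hence a priori open conditions. Over `Z`,
however, all roots are simple: the divided difference of g^{∘ r}(x) - x is nonzero on the diagonal,
so it vanishes at a pair of roots exactly when they differ (`iterDivDiff_eq_zero_iff`).

Implicit differentiation shows that the gradient times 1 - (g^{∘ r})'(β) is polynomial in (a, β).
That factor is nonzero over `Z`, so the rescaling does not affect linear independence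
(`smul_multiplierGrad`). Dependence of the rows of W then means det(W B) = 0 for every constant
matrix B (`linearIndependent_iff_exists_det_ne_zero`). Openness of `Z` is the same projection
argument applied to a multiple root (`isOpen_Zr`). -/

noncomputable section

namespace PeriodicMultipliers

/-! ### Regular functions on a complex vector space -/

section Regular

variable {E F : Type*} [NormedAddCommGroup E] [NormedSpace ℂ E]
  [NormedAddCommGroup F] [NormedSpace ℂ F]

/-- The algebra of functions on `E` generated by the continuous linear functionals. -/
def regularFunctions (E : Type*) [NormedAddCommGroup E] [NormedSpace ℂ E] :
    Subalgebra ℂ (E → ℂ) :=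
  Algebra.adjoin ℂ (Set.range fun (L : E →L[ℂ] ℂ) (v : E) => L v)

theorem clm_mem_regularFunctions (L : E →L[ℂ] ℂ) :
    (fun v => L v) ∈ regularFunctions E :=
  Algebra.subset_adjoin ⟨L, rfl⟩

theorem const_mem_regularFunctions (c : ℂ) : (fun _ => c) ∈ regularFunctions E :=
  (regularFunctions E).algebraMap_mem c

theorem sum_mem_regularFunctions {ι : Type*} {s : Finset ι} {f : ι → E → ℂ}
    (hf : ∀ i ∈ s, f i ∈ regularFunctions E) :
    (fun v => ∑ i ∈ s, f i v) ∈ regularFunctions E := by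
  have h := (regularFunctions E).sum_mem hf
  rwa [Finset.sum_fn] at h

theorem prod_mem_regularFunctions {ι : Type*} {s : Finset ι} {f : ι → E → ℂ}
    (hf : ∀ i ∈ s, f i ∈ regularFunctions E) :
    (fun v => ∏ i ∈ s, f i v) ∈ regularFunctions E := by
  have h := (regularFunctions E).prod_mem hf
  rwa [Finset.prod_fn] at h

theorem comp_mem_regularFunctions {f : F → ℂ} (hf : f ∈ regularFunctions F) (T : E →L[ℂ] F) :
    (fun v => f (T v)) ∈ regularFunctions E := by
  induction hf using Algebra.adjoin_induction with
  | mem f hf =>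
    obtain ⟨L, rfl⟩ := hf
    exact clm_mem_regularFunctions (L ∘L T)
  | algebraMap c => exact const_mem_regularFunctions c
  | add f g _ _ hf hg => exact add_mem hf hg
  | mul f g _ _ hf hg => exact mul_mem hf hg

theorem differentiable_of_mem_regularFunctions {f : E → ℂ} (hf : f ∈ regularFunctions E) :
    Differentiable ℂ f := by
  induction hf using Algebra.adjoin_induction with
  | mem f hf =>
    obtain ⟨L, rfl⟩ := hf
    exact L.differentiable
  | algebraMap c => exact differentiable_const c
  | add f g _ _ hf hg => exact hf.add hg
  | mul f g _ _ hf hg => exact hf.mul hg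

/-- Linearity and the Leibniz rule propagate this from the generators, whose derivatives are
constant. It makes the partial derivatives of the iterates and of the multiplier polynomial without
formal differentiation. -/
theorem fderiv_mem_regularFunctions {f : E → ℂ} (hf : f ∈ regularFunctions E) (w : E) :
    (fun v => fderiv ℂ f v w) ∈ regularFunctions E := by
  induction hf using Algebra.adjoin_induction with
  | mem f hf =>
    obtain ⟨L, rfl⟩ := hf
    simp only [ContinuousLinearMap.fderiv]
    exact const_mem_regularFunctions _
  | algebraMap c =>
    have h : (algebraMap ℂ (E → ℂ)) c = fun _ => c := rfl
    simp only [h, fderiv_fun_const]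
    exact const_mem_regularFunctions 0
  | add f g hf' hg' hf hg =>
    have h : (fun v => fderiv ℂ (f + g) v w) =
        (fun v => fderiv ℂ f v w) + fun v => fderiv ℂ g v w := by
      funext v
      simp [fderiv_add (differentiable_of_mem_regularFunctions hf' v)
        (differentiable_of_mem_regularFunctions hg' v)]
    rw [h]
    exact add_mem hf hg
  | mul f g hf' hg' hf hg =>
    have h : (fun v => fderiv ℂ (f * g) v w) =
        f * (fun v => fderiv ℂ g v w) + g * fun v => fderiv ℂ f v w := by
      funext v
      simp [fderiv_mul (differentiable_of_mem_regularFunctions hf' v)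
        (differentiable_of_mem_regularFunctions hg' v)]
    rw [h]
    exact add_mem (mul_mem hf' hg) (mul_mem hg' hf)

theorem exists_mvPolynomial_of_mem_regularFunctions {σ : Type*} [Fintype σ]
    {f : (σ → ℂ) → ℂ} (hf : f ∈ regularFunctions (σ → ℂ)) :
    ∃ p : MvPolynomial σ ℂ, ∀ v, MvPolynomial.eval v p = f v := by
  classical
  induction hf using Algebra.adjoin_induction with
  | mem f hf =>
    obtain ⟨L, rfl⟩ := hf
    refine ⟨∑ i, MvPolynomial.X i * MvPolynomial.C (L (Pi.single i 1)), fun v => ?_⟩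
    have h : v = ∑ i, v i • (Pi.single i 1 : σ → ℂ) := pi_eq_sum_univ' v
    conv_rhs => rw [h]
    simp only [map_sum, map_smul, smul_eq_mul, map_mul, MvPolynomial.eval_X, MvPolynomial.eval_C]
  | algebraMap c => exact ⟨MvPolynomial.C c, fun v => by simp⟩
  | add f g _ _ hf hg =>
    obtain ⟨p, hp⟩ := hf
    obtain ⟨q, hq⟩ := hg
    exact ⟨p + q, fun v => by simp [hp, hq]⟩
  | mul f g _ _ hf hg =>
    obtain ⟨p, hp⟩ := hf
    obtain ⟨q, hq⟩ := hg
    exact ⟨p * q, fun v => by simp [hp, hq]⟩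

theorem det_mem_regularFunctions {ι : Type*} [Fintype ι] [DecidableEq ι] {W : E → Matrix ι ι ℂ}
    (hW : ∀ i j, (fun v => W v i j) ∈ regularFunctions E) :
    (fun v => (W v).det) ∈ regularFunctions E := by
  simp only [Matrix.det_apply']
  exact sum_mem_regularFunctions fun s _ =>
    mul_mem (const_mem_regularFunctions _) (prod_mem_regularFunctions fun i _ => hW _ _)

end Regular

/-! ### Projections of finite covers of affine space are closed -/

/-- The monic relations make ℂ[a, x]/I integral over ℂ[a]. Lying over then lifts the maximal ideal
of a point, and the Nullstellensatz turns the lifted maximal ideal into a point of the fibre. -/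
theorem image_zeroLocus_of_integral {σ τ : Type*} [Finite σ] [Finite τ]
    (I : Ideal (MvPolynomial (σ ⊕ τ) ℂ))
    (hI : ∀ i : τ, ∃ P : Polynomial (MvPolynomial σ ℂ), P.Monic ∧
      P.eval₂ (MvPolynomial.rename Sum.inl : MvPolynomial σ ℂ →ₐ[ℂ] _).toRingHom
        (MvPolynomial.X (Sum.inr i)) ∈ I) :
    {a : σ → ℂ | ∃ x : τ → ℂ, Sum.elim a x ∈ MvPolynomial.zeroLocus ℂ I} =
      MvPolynomial.zeroLocus ℂ
        (I.comap (MvPolynomial.rename Sum.inl : MvPolynomial σ ℂ →ₐ[ℂ] _).toRingHom) := by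
  set ρ : MvPolynomial σ ℂ →+* MvPolynomial (σ ⊕ τ) ℂ :=
    (MvPolynomial.rename Sum.inl : MvPolynomial σ ℂ →ₐ[ℂ] _).toRingHom with hρ
  have hρX : ∀ i, ρ (MvPolynomial.X i) = MvPolynomial.X (Sum.inl i) := fun i => by simp [hρ]
  have hρC : ∀ c, ρ (MvPolynomial.C c) = MvPolynomial.C c := fun c => by simp [hρ]
  ext a
  constructor
  · rintro ⟨x, hx⟩ p hp
    have h := hx _ hp
    simpa [hρ, MvPolynomial.aeval_rename] using h
  · intro ha
    let f : MvPolynomial σ ℂ →+* MvPolynomial (σ ⊕ τ) ℂ ⧸ I := (Ideal.Quotient.mk I).comp ρ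
    have hint : f.IsIntegral := by
      intro y
      obtain ⟨p, rfl⟩ := Ideal.Quotient.mk_surjective y
      induction p using MvPolynomial.induction_on with
      | C c =>
        have h : Ideal.Quotient.mk I (MvPolynomial.C c) = f (MvPolynomial.C c) := by
          simp [f, hρC]
        rw [h]
        exact f.isIntegralElem_map
      | add p q hp hq => rw [map_add]; exact hp.add f hq
      | mul_X p i hp =>
        rw [map_mul]
        refine hp.mul f ?_
        rcases i with i | i
        · rw [← hρX]
          exact f.isIntegralElem_map
        · obtain ⟨P, hP, hPI⟩ := hI i
          refine ⟨P, hP, ?_⟩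
          rw [← Polynomial.hom_eval₂]
          exact Ideal.Quotient.eq_zero_iff_mem.2 hPI
    let _ := f.toAlgebra
    have : Algebra.IsIntegral (MvPolynomial σ ℂ) (MvPolynomial (σ ⊕ τ) ℂ ⧸ I) := ⟨hint⟩
    have : (MvPolynomial.vanishingIdeal ℂ {a}).IsMaximal :=
      MvPolynomial.isMaximal_iff_eq_vanishingIdeal_singleton.2 ⟨a, rfl⟩
    obtain ⟨Q, hQ, hQm⟩ := Ideal.exists_ideal_over_maximal_of_isIntegral
      (S := MvPolynomial (σ ⊕ τ) ℂ ⧸ I) (MvPolynomial.vanishingIdeal ℂ {a}) (by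
        intro p hp
        have h : ρ p ∈ I := Ideal.Quotient.eq_zero_iff_mem.1 hp
        have := ha p h
        simpa using this)
    -- Pulled back to ℂ[a, x], the ideal Q is the ideal of a point v; the elements X i - a i lie in
    -- it, which forces v to project to a.
    have := Ideal.comap_isMaximal_of_surjective (Ideal.Quotient.mk I)
      Ideal.Quotient.mk_surjective (K := Q)
    obtain ⟨v, hv⟩ := MvPolynomial.isMaximal_iff_eq_vanishingIdeal_singleton.1 this
    have hva : v ∘ Sum.inl = a := by
      funext i
      have h1 : (MvPolynomial.X i - MvPolynomial.C (a i) : MvPolynomial σ ℂ) ∈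
          MvPolynomial.vanishingIdeal ℂ {a} := by simp
      rw [← hQm] at h1
      have h2 : ρ (MvPolynomial.X i - MvPolynomial.C (a i)) ∈ Q.comap (Ideal.Quotient.mk I) := h1
      rw [hv, map_sub, hρX, hρC] at h2
      simpa [sub_eq_zero] using h2
    refine ⟨v ∘ Sum.inr, ?_⟩
    rw [← hva, Sum.elim_comp_inl_inr]
    intro p hp
    have h1 : p ∈ Q.comap (Ideal.Quotient.mk I) := by
      rw [Ideal.mem_comap, Ideal.Quotient.eq_zero_iff_mem.2 hp]
      exact Q.zero_mem
    rw [hv] at h1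
    simpa using h1

/-! ### The universal polynomial and its iterates -/

/-- The polynomial `xⁿ + ∑ aᵢ xⁱ` with indeterminate coefficients. -/
def genericPoly (n : ℕ) : Polynomial (MvPolynomial (Fin n) ℂ) :=
  Polynomial.X ^ n + ∑ i : Fin n, Polynomial.C (MvPolynomial.X i) * Polynomial.X ^ (i : ℕ)

/-- The polynomial `g^{∘ r}(x) - x` for `g` with indeterminate coefficients. -/
def genericIter (n r : ℕ) : Polynomial (MvPolynomial (Fin n) ℂ) :=
  (genericPoly n).comp^[r] Polynomial.X - Polynomial.X

theorem degree_genericPoly_tail_lt (n : ℕ) :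
    (∑ i : Fin n, Polynomial.C (MvPolynomial.X i : MvPolynomial (Fin n) ℂ) *
      Polynomial.X ^ (i : ℕ)).degree < (n : WithBot ℕ) := by
  refine (Polynomial.degree_sum_le _ _).trans_lt ((Finset.sup_lt_iff (WithBot.bot_lt_coe n)).2 ?_)
  intro i _
  exact (Polynomial.degree_C_mul_X_pow_le _ _).trans_lt (WithBot.coe_lt_coe.2 i.2)

theorem monic_genericPoly (n : ℕ) : (genericPoly n).Monic :=
  Polynomial.monic_X_pow_add (degree_genericPoly_tail_lt n)

theorem natDegree_genericPoly (n : ℕ) : (genericPoly n).natDegree = n := by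
  refine Polynomial.natDegree_eq_of_degree_eq_some ?_
  rw [genericPoly, Polynomial.degree_add_eq_left_of_degree_lt, Polynomial.degree_X_pow]
  rw [Polynomial.degree_X_pow]
  exact degree_genericPoly_tail_lt n

/-- The iterate is monic of degree n ^ r > 1, so subtracting X does not touch the leading term. -/
theorem monic_genericIter {n r : ℕ} (hn : 2 ≤ n) (hr : 1 ≤ r) : (genericIter n r).Monic := by
  have hdeg : ∀ k, ((genericPoly n).comp^[k] Polynomial.X).natDegree = n ^ k := fun k => by
    rw [Polynomial.natDegree_iterate_comp, natDegree_genericPoly, Polynomial.natDegree_X, mul_one]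
  have hmon : ∀ k, ((genericPoly n).comp^[k] Polynomial.X).Monic := by
    intro k
    induction k with
    | zero => exact Polynomial.monic_X
    | succ k ih =>
      rw [Function.iterate_succ_apply']
      refine (monic_genericPoly n).comp ih ?_
      rw [hdeg]
      positivity
  refine (hmon r).sub_of_left (Polynomial.degree_lt_degree ?_)
  rw [Polynomial.natDegree_X, hdeg]
  exact Nat.one_lt_pow (by omega) (by omega)

theorem map_genericIter {n : ℕ} (r : ℕ) (a : Fin n → ℂ) :
    (genericIter n r).map (MvPolynomial.eval a) = iter r a - Polynomial.X := by
  have h0 : (genericPoly n).map (MvPolynomial.eval a) = monicPoly a := by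
    simp [genericPoly, monicPoly, Polynomial.map_sum]
  have h : ∀ k, ((genericPoly n).comp^[k] Polynomial.X).map (MvPolynomial.eval a) =
      (monicPoly a).comp^[k] Polynomial.X := by
    intro k
    induction k with
    | zero => simp
    | succ k ih => rw [Function.iterate_succ_apply', Function.iterate_succ_apply',
        Polynomial.map_comp, ih, h0]
  rw [genericIter, Polynomial.map_sub, h, Polynomial.map_X, iter]

/-- If `S` is a set of regular functions of `(a, x)` containing the functions
`g^{∘ r i}(x i) - x i`, the projection of the zero set of `S` to the space of the `a` is Zariski
closed. -/
theorem isOpen_compl_projection {n m : ℕ} (hn : 2 ≤ n) {r : Fin m → ℕ} (hr : ∀ i, 1 ≤ r i)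
    (S : Set ((Fin n → ℂ) × (Fin m → ℂ) → ℂ)) (hS : ∀ f ∈ S, f ∈ regularFunctions ((Fin n → ℂ) × (Fin m → ℂ)))
    (hroot : ∀ i, (fun v => (iter (r i) v.1).eval (v.2 i) - v.2 i) ∈ S) :
    IsOpen[zariskiTopology n] {a | ∃ x, ∀ f ∈ S, f (a, x) = 0}ᶜ := by
  let T : (Fin n ⊕ Fin m → ℂ) →L[ℂ] (Fin n → ℂ) × (Fin m → ℂ) :=
    (ContinuousLinearMap.pi fun i => ContinuousLinearMap.proj (Sum.inl i)).prod
      (ContinuousLinearMap.pi fun i => ContinuousLinearMap.proj (Sum.inr i))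
  have hT : ∀ a x, T (Sum.elim a x) = (a, x) := fun a x => rfl
  let I : Ideal (MvPolynomial (Fin n ⊕ Fin m) ℂ) :=
    Ideal.span {p | ∃ f ∈ S, ∀ v, MvPolynomial.eval v p = f (T v)}
  have hmem : ∀ a x, Sum.elim a x ∈ MvPolynomial.zeroLocus ℂ I ↔ ∀ f ∈ S, f (a, x) = 0 := by
    intro a x
    rw [MvPolynomial.zeroLocus_span]
    constructor
    · intro h f hf
      obtain ⟨p, hp⟩ := exists_mvPolynomial_of_mem_regularFunctions
        (comp_mem_regularFunctions (hS f hf) T)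
      have h1 := h p ⟨f, hf, hp⟩
      rwa [MvPolynomial.aeval_eq_eval, hp, hT] at h1
    · rintro h p ⟨f, hf, hp⟩
      rw [MvPolynomial.aeval_eq_eval, hp, hT]
      exact h f hf
  simp only [← hmem]
  -- The integral equation of the i-th coordinate is `genericIter n (r i)`; evaluated there it
  -- represents the root function in S, hence lies in I.
  refine ⟨_, (compl_compl _).trans <| image_zeroLocus_of_integral I fun i => ⟨genericIter n (r i), monic_genericIter hn (hr i),
    Ideal.subset_span ⟨_, hroot i, fun v => ?_⟩⟩⟩
  have h1 : (MvPolynomial.eval v).comp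
      (MvPolynomial.rename Sum.inl : MvPolynomial (Fin n) ℂ →ₐ[ℂ] _).toRingHom =
      MvPolynomial.eval (T v).1 := by
    ext j
    · simp
    · simp [T]
  rw [Polynomial.hom_eval₂, h1, MvPolynomial.eval_X, ← Polynomial.eval_map, map_genericIter]
  simp [T]

/-! ### Regularity of the dynamical functions -/

section Dynamics

variable {E : Type*} [NormedAddCommGroup E] [NormedSpace ℂ E] {n : ℕ}

theorem iterate_polyMap_mem_regularFunctions {A : E → Fin n → ℂ} {x : E → ℂ}
    (hA : ∀ i, (fun v => A v i) ∈ regularFunctions E) (hx : x ∈ regularFunctions E) (k : ℕ) :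
    (fun v => (polyMap (A v))^[k] (x v)) ∈ regularFunctions E := by
  induction k with
  | zero => exact hx
  | succ k ih =>
    simp only [Function.iterate_succ_apply', polyMap_eq]
    exact add_mem (pow_mem ih n) (sum_mem_regularFunctions fun i _ => mul_mem (hA i) (pow_mem ih i))

/-! ### Divided differences -/

/-- The divided difference `(g(x) - g(y)) / (x - y)`. -/
def divDiff (a : Fin n → ℂ) (x y : ℂ) : ℂ :=
  ∑ j ∈ Finset.range n, x ^ j * y ^ (n - 1 - j) +
    ∑ i : Fin n, a i * ∑ j ∈ Finset.range i, x ^ j * y ^ ((i : ℕ) - 1 - j)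

theorem divDiff_mul (a : Fin n → ℂ) (x y : ℂ) :
    divDiff a x y * (x - y) = polyMap a x - polyMap a y := by
  rw [divDiff, add_mul, geom_sum₂_mul, Finset.sum_mul, polyMap_eq, polyMap_eq]
  simp only [mul_assoc, geom_sum₂_mul]
  simp only [mul_sub, Finset.sum_sub_distrib]
  ring

/-- The divided difference of `g^{∘ r}(x) - x`. -/
def iterDivDiff (r : ℕ) (a : Fin n → ℂ) (x y : ℂ) : ℂ :=
  ∏ k ∈ Finset.range r, divDiff a ((polyMap a)^[k] x) ((polyMap a)^[k] y) - 1

/-- The divided differences of g along the two orbits telescope; the final -1 accounts for the term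
-x. -/
theorem iterDivDiff_mul (r : ℕ) (a : Fin n → ℂ) (x y : ℂ) :
    iterDivDiff r a x y * (x - y) =
      ((polyMap a)^[r] x - x) - ((polyMap a)^[r] y - y) := by
  have h : (∏ k ∈ Finset.range r, divDiff a ((polyMap a)^[k] x) ((polyMap a)^[k] y)) * (x - y) =
      (polyMap a)^[r] x - (polyMap a)^[r] y := by
    induction r with
    | zero => simp
    | succ r ih =>
      rw [Finset.prod_range_succ, mul_right_comm, ih, mul_comm, divDiff_mul,
        Function.iterate_succ_apply', Function.iterate_succ_apply']
  rw [iterDivDiff, sub_mul, h]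
  ring

theorem divDiff_mem_regularFunctions {A : E → Fin n → ℂ} {x y : E → ℂ}
    (hA : ∀ i, (fun v => A v i) ∈ regularFunctions E) (hx : x ∈ regularFunctions E)
    (hy : y ∈ regularFunctions E) :
    (fun v => divDiff (A v) (x v) (y v)) ∈ regularFunctions E :=
  add_mem
    (sum_mem_regularFunctions fun j _ => mul_mem (pow_mem hx j) (pow_mem hy _))
    (sum_mem_regularFunctions fun i _ => mul_mem (hA i)
      (sum_mem_regularFunctions fun j _ => mul_mem (pow_mem hx j) (pow_mem hy _)))

theorem iterDivDiff_mem_regularFunctions {A : E → Fin n → ℂ} {x y : E → ℂ} (r : ℕ)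
    (hA : ∀ i, (fun v => A v i) ∈ regularFunctions E) (hx : x ∈ regularFunctions E)
    (hy : y ∈ regularFunctions E) :
    (fun v => iterDivDiff r (A v) (x v) (y v)) ∈ regularFunctions E :=
  sub_mem
    (prod_mem_regularFunctions fun k _ => divDiff_mem_regularFunctions hA
      (iterate_polyMap_mem_regularFunctions hA hx k)
      (iterate_polyMap_mem_regularFunctions hA hy k))
    (const_mem_regularFunctions 1)

theorem iterDivDiff_self (r : ℕ) (a : Fin n → ℂ) (y : ℂ) :
    iterDivDiff r a y y = (Polynomial.derivative (iter r a)).eval y - 1 := by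
  have hreg : (fun x => iterDivDiff r a x y) ∈ regularFunctions ℂ :=
    iterDivDiff_mem_regularFunctions r (fun i => const_mem_regularFunctions (a i))
      (clm_mem_regularFunctions (ContinuousLinearMap.id ℂ ℂ)) (const_mem_regularFunctions y)
  have hd := (differentiable_of_mem_regularFunctions hreg y).hasDerivAt
  -- In the product with x - y, only the term differentiating x - y survives at x = y.
  have h1 := (hd.mul ((hasDerivAt_id y).sub_const y)).add_const ((polyMap a)^[r] y - y)
  have h2 := ((iter r a).hasDerivAt y).sub (hasDerivAt_id y)
  have h3 : (fun x => ((fun x => iterDivDiff r a x y) * fun x => id x - y) x +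
      ((polyMap a)^[r] y - y)) = (fun x => (iter r a).eval x) - id := by
    funext x
    simp [iterDivDiff_mul, eval_iter]
  rw [h3] at h1
  have h4 := h1.unique h2
  simpa using h4

/-- Two roots of `g^{∘ r}(x) - x` are distinct exactly when the divided difference vanishes,
provided the roots are simple. -/
theorem iterDivDiff_eq_zero_iff {r : ℕ} {a : Fin n → ℂ} {x y : ℂ} (hn : 2 ≤ n) (hr : 1 ≤ r)
    (ha : a ∈ Zr n r) (hx : (polyMap a)^[r] x = x) (hy : (polyMap a)^[r] y = y) :
    iterDivDiff r a x y = 0 ↔ x ≠ y := by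
  constructor
  · rintro h rfl
    rw [iterDivDiff_self, sub_eq_zero] at h
    exact derivative_iter_ne_one hn hr ha (by rw [eval_iter, hx]) h
  · intro h
    have h1 := iterDivDiff_mul r a x y
    rw [hx, hy, sub_self, sub_self, sub_self] at h1
    exact (mul_eq_zero.1 h1).resolve_right (sub_ne_zero.2 h)

theorem eval_iter_mem_regularFunctions (n r : ℕ) :
    (fun v : (Fin n → ℂ) × ℂ => (iter r v.1).eval v.2) ∈ regularFunctions ((Fin n → ℂ) × ℂ) := by
  simp only [eval_iter]
  exact iterate_polyMap_mem_regularFunctions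
    (fun i => clm_mem_regularFunctions
      (ContinuousLinearMap.proj (φ := fun _ : Fin n => ℂ) i ∘L
        ContinuousLinearMap.fst ℂ (Fin n → ℂ) ℂ))
    (clm_mem_regularFunctions (ContinuousLinearMap.snd ℂ (Fin n → ℂ) ℂ)) r

theorem fderiv_eval_iter_inr (r : ℕ) (v : (Fin n → ℂ) × ℂ) :
    fderiv ℂ (fun v : (Fin n → ℂ) × ℂ => (iter r v.1).eval v.2) v (0, 1) =
      (Polynomial.derivative (iter r v.1)).eval v.2 := by
  obtain ⟨a, x⟩ := v
  have h1 : HasFDerivAt (fun z : ℂ => (iter r a).eval z)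
      (fderiv ℂ (fun v : (Fin n → ℂ) × ℂ => (iter r v.1).eval v.2) (a, x) ∘L
        ContinuousLinearMap.inr ℂ (Fin n → ℂ) ℂ) x :=
    (differentiable_of_mem_regularFunctions (eval_iter_mem_regularFunctions n r)
      (a, x)).hasFDerivAt.comp x (hasFDerivAt_prodMk_right (𝕜 := ℂ) a x)
  have h2 := congrArg (fun L => L 1) (h1.unique ((iter r a).hasDerivAt x).hasFDerivAt)
  simpa using h2

theorem derivative_iter_mem_regularFunctions (n r : ℕ) :
    (fun v : (Fin n → ℂ) × ℂ => (Polynomial.derivative (iter r v.1)).eval v.2) ∈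
      regularFunctions ((Fin n → ℂ) × ℂ) := by
  simp only [← fderiv_eval_iter_inr]
  exact fderiv_mem_regularFunctions (eval_iter_mem_regularFunctions n r) (0, 1)

/-! ### The gradient of the multiplier -/

/-- The gradient of the multiplier, cleared of its denominator `1 - (g^{∘ r})'(x)`. -/
def clearedGrad (r : ℕ) (v : (Fin n → ℂ) × ℂ) (k : Fin n) : ℂ :=
  fderiv ℂ (fun v : (Fin n → ℂ) × ℂ => (Polynomial.derivative (iter r v.1)).eval v.2) v
      (Pi.single k 1, 0) * (1 - (Polynomial.derivative (iter r v.1)).eval v.2) +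
    fderiv ℂ (fun v : (Fin n → ℂ) × ℂ => (Polynomial.derivative (iter r v.1)).eval v.2) v
      (0, 1) * fderiv ℂ (fun v : (Fin n → ℂ) × ℂ => (iter r v.1).eval v.2) v (Pi.single k 1, 0)

theorem clearedGrad_mem_regularFunctions (r : ℕ) (k : Fin n) :
    (fun v => clearedGrad r v k) ∈ regularFunctions ((Fin n → ℂ) × ℂ) := by
  have hF := eval_iter_mem_regularFunctions n r
  have hM := derivative_iter_mem_regularFunctions n r
  exact add_mem
    (mul_mem (fderiv_mem_regularFunctions hM _) (sub_mem (const_mem_regularFunctions 1) hM))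
    (mul_mem (fderiv_mem_regularFunctions hM _) (fderiv_mem_regularFunctions hF _))

/-- Differentiating g^{∘ r}(b(a)) = b(a) in a gives (1 - (g^{∘ r})') ∂b as a partial derivative of
the iterate; this eliminates ∂b from the chain rule for the multiplier. -/
theorem smul_multiplierGrad {r : ℕ} {a : Fin n → ℂ} {β : ℂ} (hβ : (iter r a).eval β = β)
    (h : (Polynomial.derivative (iter r a)).eval β ≠ 1) :
    (1 - (Polynomial.derivative (iter r a)).eval β) • multiplierGrad r a β =
      clearedGrad r (a, β) := by
  obtain ⟨b, hb⟩ := exists_isRootBranch hβ h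
  rw [hb.multiplierGrad_eq h]
  have hdb := hb.analyticAt.differentiableAt.hasFDerivAt
  have hgraph := (hasFDerivAt_id (𝕜 := ℂ) a).prodMk hdb
  have hF : HasFDerivAt (fun v : (Fin n → ℂ) × ℂ => (iter r v.1).eval v.2)
      (fderiv ℂ (fun v : (Fin n → ℂ) × ℂ => (iter r v.1).eval v.2) (a, β)) (id a, b a) := by
    rw [hb.apply_self]
    exact (differentiable_of_mem_regularFunctions
      (eval_iter_mem_regularFunctions n r) _).hasFDerivAt
  have hM : HasFDerivAt
      (fun v : (Fin n → ℂ) × ℂ => (Polynomial.derivative (iter r v.1)).eval v.2)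
      (fderiv ℂ (fun v : (Fin n → ℂ) × ℂ => (Polynomial.derivative (iter r v.1)).eval v.2)
        (a, β)) (id a, b a) := by
    rw [hb.apply_self]
    exact (differentiable_of_mem_regularFunctions
      (derivative_iter_mem_regularFunctions n r) _).hasFDerivAt
  have hFb := hF.comp a hgraph
  change HasFDerivAt (fun a' => (iter r a').eval (b a')) _ a at hFb
  have hroot := hFb.unique (hdb.congr_of_eventuallyEq hb.eventually_root)
  have hMb := hM.comp a hgraph
  change HasFDerivAt (multiplier r b) _ a at hMb
  have hmult := hMb.fderiv
  have hsplit : ∀ (w : Fin n → ℂ) (t : ℂ), ((w, t) : (Fin n → ℂ) × ℂ) = (w, 0) + t • (0, 1) :=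
    fun w t => by simp
  have hM1 := fderiv_eval_iter_inr r (a, β)
  funext k
  have hrootk := congrArg (fun L => L (Pi.single k 1)) hroot
  have hmultk := congrArg (fun L => L (Pi.single k 1)) hmult
  simp only [ContinuousLinearMap.comp_apply, ContinuousLinearMap.prod_apply,
    ContinuousLinearMap.id_apply] at hrootk hmultk
  rw [hsplit (Pi.single k 1), map_add, map_smul, smul_eq_mul] at hrootk hmultk
  rw [hM1] at hrootk
  simp only [Pi.smul_apply, smul_eq_mul, hmultk, clearedGrad]
  linear_combination (-fderiv ℂ (fun v : (Fin n → ℂ) × ℂ =>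
    (Polynomial.derivative (iter r v.1)).eval v.2) (a, β) (0, 1)) * hrootk

end Dynamics

/-- Rows of a rectangular matrix are independent exactly when some constant matrix makes the
product invertible. -/
theorem linearIndependent_iff_exists_det_ne_zero {ι κ : Type*} [Fintype ι] [DecidableEq ι]
    [Fintype κ] (W : ι → κ → ℂ) :
    LinearIndependent ℂ W ↔ ∃ B : Matrix κ ι ℂ, (Matrix.of W * B).det ≠ 0 := by
  classical
  have hrow : LinearIndependent ℂ W ↔ LinearIndependent ℂ (Matrix.of W).row := Iff.rfl
  rw [hrow, ← Matrix.vecMul_injective_iff]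
  constructor
  · intro h
    -- The matrix of a left inverse serves as B, making the product the identity.
    obtain ⟨g, hg⟩ := LinearMap.exists_leftInverse_of_injective (Matrix.of W).vecMulLinear
      (LinearMap.ker_eq_bot.2 h)
    refine ⟨LinearMap.toMatrixRight' g, ?_⟩
    have h1 : Matrix.of W * LinearMap.toMatrixRight' g = 1 := by
      apply Matrix.toLinearMapRight'.injective
      rw [Matrix.toLinearMapRight'_mul, Matrix.toLinearMapRight'_one]
      refine Eq.trans ?_ hg
      congr 1
      exact LinearMap.toMatrixRight'.symm_apply_apply g
    rw [h1, Matrix.det_one]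
    exact one_ne_zero
  · rintro ⟨B, hB⟩
    have h1 := Matrix.vecMul_injective_of_isUnit
      ((Matrix.isUnit_iff_isUnit_det _).2 (isUnit_iff_ne_zero.2 hB))
    intro x y hxy
    refine h1 ?_
    simp only [← Matrix.vecMul_vecMul]
    exact congrArg (fun z => Matrix.vecMul z B) hxy

/-! ### Zariski openness -/

theorem mem_Zr_iff {n r : ℕ} (hn : 2 ≤ n) (hr : 1 ≤ r) (a : Fin n → ℂ) :
    a ∈ Zr n r ↔ ∀ x, (iter r a).eval x = x → (Polynomial.derivative (iter r a)).eval x ≠ 1 := by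
  refine ⟨fun ha x hx => derivative_iter_ne_one hn hr ha hx, fun h => ?_⟩
  have hne : iter r a - Polynomial.X ≠ 0 := sub_ne_zero.2 (iter_ne_X hn hr a)
  refine Multiset.nodup_iff_count_le_one.2 fun x => ?_
  by_contra! hx
  rw [Polynomial.count_roots, Polynomial.one_lt_rootMultiplicity_iff_isRoot hne] at hx
  obtain ⟨h1, h2⟩ := hx
  refine h x ?_ ?_
  · simpa [sub_eq_zero] using h1
  · simpa [sub_eq_zero] using h2

/-- The continuous linear map `(a, x) ↦ (a, x i)`. -/
def selectCLM (n : ℕ) {m : ℕ} (i : Fin m) :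
    (Fin n → ℂ) × (Fin m → ℂ) →L[ℂ] (Fin n → ℂ) × ℂ :=
  (ContinuousLinearMap.fst ℂ _ _).prod
    (ContinuousLinearMap.proj (φ := fun _ : Fin m => ℂ) i ∘L
        ContinuousLinearMap.snd ℂ (Fin n → ℂ) (Fin m → ℂ))

theorem root_mem_regularFunctions (n r : ℕ) {m : ℕ} (i : Fin m) :
    (fun v : (Fin n → ℂ) × (Fin m → ℂ) => (iter r v.1).eval (v.2 i) - v.2 i) ∈
      regularFunctions ((Fin n → ℂ) × (Fin m → ℂ)) :=
  sub_mem (comp_mem_regularFunctions (eval_iter_mem_regularFunctions n r) (selectCLM n i))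
    (clm_mem_regularFunctions
      (ContinuousLinearMap.proj (φ := fun _ : Fin m => ℂ) i ∘L
        ContinuousLinearMap.snd ℂ (Fin n → ℂ) (Fin m → ℂ)))

theorem isOpen_Zr {n r : ℕ} (hn : 2 ≤ n) (hr : 1 ≤ r) : IsOpen[zariskiTopology n] (Zr n r) := by
  have h := isOpen_compl_projection (m := 1) hn (r := fun _ => r) (fun _ => hr)
    {fun v => (iter r v.1).eval (v.2 0) - v.2 0,
      fun v => (Polynomial.derivative (iter r v.1)).eval (v.2 0) - 1}
    (by
      rintro f (rfl | rfl)
      · exact root_mem_regularFunctions n r 0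
      · exact sub_mem (comp_mem_regularFunctions (derivative_iter_mem_regularFunctions n r)
          (selectCLM n 0)) (const_mem_regularFunctions 1))
    (fun i => by
      rw [Subsingleton.elim i 0]
      exact Set.mem_insert _ _)
  -- A bad g is one with a point where the iterate fixes x with derivative 1, that is, a multiple
  -- root.
  convert h using 1
  ext a
  rw [mem_Zr_iff hn hr]
  simp only [Set.mem_compl_iff, Set.mem_ofPred_eq, Set.mem_insert_iff, Set.mem_singleton_iff,
    forall_eq_or_imp, forall_eq, sub_eq_zero, not_exists, not_and]
  exact ⟨fun h x => h (x 0), fun h x => h fun _ => x⟩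

theorem minimalPeriod_eq_iff {α : Type*} {f : α → α} {x : α} {r : ℕ} (hr : 1 ≤ r) :
    Function.minimalPeriod f x = r ↔ f^[r] x = x ∧ ∀ k ∈ Finset.Ico 1 r, x ≠ f^[k] x := by
  constructor
  · rintro rfl
    refine ⟨Function.isPeriodicPt_minimalPeriod f x, fun k hk h => ?_⟩
    rw [Finset.mem_Ico] at hk
    exact Function.not_isPeriodicPt_of_pos_of_lt_minimalPeriod (by omega) hk.2 h.symm
  · rintro ⟨h1, h2⟩
    have hp : Function.IsPeriodicPt f r x := h1
    have hle := hp.minimalPeriod_le hr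
    have hpos := hp.minimalPeriod_pos hr
    by_contra hne
    exact h2 _ (Finset.mem_Ico.2 ⟨hpos, lt_of_le_of_ne hle hne⟩)
      (Function.isPeriodicPt_minimalPeriod f x).symm

/-- Periodic orbits are equal or disjoint, and exponents reduce modulo the period, so finitely many
inequalities suffice. -/
theorem periodicOrbit_ne_iff {α : Type*} {f : α → α} {x y : α} {r : ℕ} (hr : 1 ≤ r)
    (hx : Function.minimalPeriod f x = r) (hy : Function.minimalPeriod f y = r) :
    Function.periodicOrbit f x ≠ Function.periodicOrbit f y ↔
      ∀ k ∈ Finset.range r, x ≠ f^[k] y := by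
  have hpx : x ∈ Function.periodicPts f := Function.minimalPeriod_pos_iff_mem_periodicPts.1
    (by omega)
  have hpy : y ∈ Function.periodicPts f := Function.minimalPeriod_pos_iff_mem_periodicPts.1
    (by omega)
  constructor
  · intro h k _ hk
    apply h
    rw [hk, Function.periodicOrbit_apply_iterate_eq hpy]
  · intro h he
    have h1 : x ∈ Function.periodicOrbit f y :=
      he ▸ Function.self_mem_periodicOrbit hpx
    obtain ⟨k, hk⟩ := (Function.mem_periodicOrbit_iff hpy).1 h1
    refine h (k % r) (Finset.mem_range.2 (Nat.mod_lt _ hr)) ?_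
    rw [← hk, ← hy, Function.iterate_mod_minimalPeriod_eq]

/-- The regular functions of `(a, β)` that cut out, above `Z n ℓ r`, the tuples `β` of points of
exact periods `r i` in distinct orbits whose multipliers have linearly dependent gradients. -/
def dependenceFunctions (n ℓ : ℕ) (r : Fin ℓ → ℕ) : Set ((Fin n → ℂ) × (Fin ℓ → ℂ) → ℂ) :=
  {f | ∃ i, f = fun v => (iter (r i) v.1).eval (v.2 i) - v.2 i} ∪
  {f | ∃ i, ∃ k ∈ Finset.Ico 1 (r i),
    f = fun v => iterDivDiff (r i) v.1 (v.2 i) ((polyMap v.1)^[k] (v.2 i))} ∪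
  -- Only equal periods need an equation: orbits of different lengths are distinct, and the divided
  -- difference criterion needs two roots of the same iterate.
  {f | ∃ i j, i ≠ j ∧ r i = r j ∧ ∃ k ∈ Finset.range (r i),
    f = fun v => iterDivDiff (r i) v.1 (v.2 i) ((polyMap v.1)^[k] (v.2 j))} ∪
  {f | ∃ B : Matrix (Fin n) (Fin ℓ) ℂ,
    f = fun v => (Matrix.of (fun i => clearedGrad (r i) (v.1, v.2 i)) * B).det}

theorem dependenceFunctions_regular (n ℓ : ℕ) (r : Fin ℓ → ℕ) :
    ∀ f ∈ dependenceFunctions n ℓ r, f ∈ regularFunctions ((Fin n → ℂ) × (Fin ℓ → ℂ)) := by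
  have hA : ∀ i, (fun v : (Fin n → ℂ) × (Fin ℓ → ℂ) => v.1 i) ∈ regularFunctions _ := fun i =>
    clm_mem_regularFunctions
      (ContinuousLinearMap.proj (φ := fun _ : Fin n => ℂ) i ∘L
        ContinuousLinearMap.fst ℂ (Fin n → ℂ) (Fin ℓ → ℂ))
  have hx : ∀ i, (fun v : (Fin n → ℂ) × (Fin ℓ → ℂ) => v.2 i) ∈ regularFunctions _ := fun i =>
    clm_mem_regularFunctions
      (ContinuousLinearMap.proj (φ := fun _ : Fin ℓ => ℂ) i ∘L
        ContinuousLinearMap.snd ℂ (Fin n → ℂ) (Fin ℓ → ℂ))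
  rintro f (((⟨i, rfl⟩ | ⟨i, k, -, rfl⟩) | ⟨i, j, -, -, k, -, rfl⟩) | ⟨B, rfl⟩)
  · exact root_mem_regularFunctions n (r i) i
  · exact iterDivDiff_mem_regularFunctions (r i) hA (hx i)
      (iterate_polyMap_mem_regularFunctions hA (hx i) k)
  · exact iterDivDiff_mem_regularFunctions (r i) hA (hx i)
      (iterate_polyMap_mem_regularFunctions hA (hx j) k)
  · refine det_mem_regularFunctions fun i j => ?_
    simp only [Matrix.mul_apply, Matrix.of_apply]
    exact sum_mem_regularFunctions fun k _ => mul_mem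
      (comp_mem_regularFunctions (clearedGrad_mem_regularFunctions (r i) k) (selectCLM n i))
      (const_mem_regularFunctions _)

theorem dependenceFunctions_eq_zero_iff {n ℓ : ℕ} {r : Fin ℓ → ℕ} (hn : 2 ≤ n)
    (hr : ∀ i, 1 ≤ r i) {a : Fin n → ℂ} (ha : a ∈ Z n ℓ r) (β : Fin ℓ → ℂ) :
    (∀ f ∈ dependenceFunctions n ℓ r, f (a, β) = 0) ↔
      (∀ i, Function.minimalPeriod (polyMap a) (β i) = r i) ∧
      (Pairwise fun i j =>
        Function.periodicOrbit (polyMap a) (β i) ≠ Function.periodicOrbit (polyMap a) (β j)) ∧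
      ¬ LinearIndependent ℂ fun i => multiplierGrad (r i) a (β i) := by
  have ha' : ∀ i, a ∈ Zr n (r i) := fun i => Set.mem_iInter.1 ha i
  have hsplit : (∀ f ∈ dependenceFunctions n ℓ r, f (a, β) = 0) ↔
      (∀ i, (polyMap a)^[r i] (β i) = β i) ∧
      (∀ i, ∀ k ∈ Finset.Ico 1 (r i),
        iterDivDiff (r i) a (β i) ((polyMap a)^[k] (β i)) = 0) ∧
      (∀ i j, i ≠ j → r i = r j → ∀ k ∈ Finset.range (r i),
        iterDivDiff (r i) a (β i) ((polyMap a)^[k] (β j)) = 0) ∧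
      ∀ B : Matrix (Fin n) (Fin ℓ) ℂ,
        (Matrix.of (fun i => clearedGrad (r i) (a, β i)) * B).det = 0 := by
    constructor
    · intro h
      refine ⟨fun i => (eval_iter _ _ _).symm.trans <| sub_eq_zero.1 (h _ (Or.inl (Or.inl (Or.inl ⟨i, rfl⟩)))),
        fun i k hk => h _ (Or.inl (Or.inl (Or.inr ⟨i, k, hk, rfl⟩))),
        fun i j hij hrij k hk => h _ (Or.inl (Or.inr ⟨i, j, hij, hrij, k, hk, rfl⟩)),
        fun B => h _ (Or.inr ⟨B, rfl⟩)⟩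
    · rintro ⟨h1, h2, h3, h4⟩ f
        (((⟨i, rfl⟩ | ⟨i, k, hk, rfl⟩) | ⟨i, j, hij, hrij, k, hk, rfl⟩) | ⟨B, rfl⟩)
      · exact sub_eq_zero.2 ((eval_iter _ _ _).trans (h1 i))
      · exact h2 i k hk
      · exact h3 i j hij hrij k hk
      · exact h4 B
  rw [hsplit]
  -- Iterates of a root are again roots, so the divided difference criterion applies to them.
  have hiter : ∀ {s k : ℕ} {x : ℂ}, (polyMap a)^[s] x = x →
      (polyMap a)^[s] ((polyMap a)^[k] x) = (polyMap a)^[k] x := fun {s k x} hx => by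
    rw [(Function.Commute.refl (polyMap a)).iterate_iterate s k x, hx]
  have hper : ((∀ i, (polyMap a)^[r i] (β i) = β i) ∧ ∀ i, ∀ k ∈ Finset.Ico 1 (r i),
        iterDivDiff (r i) a (β i) ((polyMap a)^[k] (β i)) = 0) ↔
      ∀ i, Function.minimalPeriod (polyMap a) (β i) = r i := by
    rw [← forall_and]
    refine forall_congr' fun i => ?_
    rw [minimalPeriod_eq_iff (hr i)]
    refine and_congr_right fun hi => forall₂_congr fun k _ => ?_
    exact iterDivDiff_eq_zero_iff hn (hr i) (ha' i) hi (hiter hi)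
  rw [← and_assoc, hper]
  refine and_congr_right fun hmin => and_congr ?_ ?_
  · have hfix : ∀ i, (polyMap a)^[r i] (β i) = β i := fun i =>
      ((minimalPeriod_eq_iff (hr i)).1 (hmin i)).1
    refine forall₃_congr fun i j hij => ?_
    change _ ↔ Function.periodicOrbit (polyMap a) (β i) ≠ Function.periodicOrbit (polyMap a) (β j)
    by_cases hrij : r i = r j
    · rw [periodicOrbit_ne_iff (hr i) (hmin i) (hrij.symm ▸ hmin j)]
      simp only [hrij, true_imp_iff]
      refine forall₂_congr fun k _ => ?_
      rw [← hrij]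
      exact iterDivDiff_eq_zero_iff hn (hr i) (ha' i) (hfix i) (hiter (hrij.symm ▸ hfix j))
    · refine iff_of_true (fun h => absurd h hrij) fun he => hrij ?_
      rw [← hmin i, ← hmin j, ← Function.periodicOrbit_length, he, Function.periodicOrbit_length]
  · have hfix : ∀ i, (iter (r i) a).eval (β i) = β i := fun i => by
      rw [eval_iter]
      exact ((minimalPeriod_eq_iff (hr i)).1 (hmin i)).1
    have hne : ∀ i, (Polynomial.derivative (iter (r i) a)).eval (β i) ≠ 1 := fun i =>
      derivative_iter_ne_one hn (hr i) (ha' i) (hfix i)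
    -- Simplicity of the roots makes the denominators units.
    let u : Fin ℓ → ℂˣ := fun i =>
      Units.mk0 (1 - (Polynomial.derivative (iter (r i) a)).eval (β i))
        (sub_ne_zero.2 (hne i).symm)
    have hu : (fun i => clearedGrad (r i) (a, β i)) =
        u • fun i => multiplierGrad (r i) a (β i) :=
      funext fun i => (smul_multiplierGrad (hfix i) (hne i)).symm
    rw [← LinearIndependent.units_smul_iff _ u, ← hu, linearIndependent_iff_exists_det_ne_zero]
    push Not
    rfl

theorem isOpen_Z0 {n ℓ : ℕ} (hn : 2 ≤ n) {r : Fin ℓ → ℕ} (hr : ∀ i, 1 ≤ r i) :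
    IsOpen[zariskiTopology n] (Z0 n ℓ r) := by
  have hZ : IsOpen[zariskiTopology n] (Z n ℓ r) :=
    @isOpen_iInter_of_finite _ _ (zariskiTopology n) _ _ fun i => isOpen_Zr hn (hr i)
  have hW := isOpen_compl_projection hn hr (dependenceFunctions n ℓ r)
    (dependenceFunctions_regular n ℓ r) fun i => Or.inl (Or.inl (Or.inl ⟨i, rfl⟩))
  convert @IsOpen.inter _ (zariskiTopology n) _ _ hZ hW using 1
  ext a
  refine and_congr_right fun ha => ?_
  simp only [Set.mem_compl_iff, Set.mem_ofPred_eq, dependenceFunctions_eq_zero_iff hn hr ha,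
    not_exists, not_and, not_not]

end PeriodicMultipliers

end

theorem theorem1p1 (n ℓ : ℕ) (hn : 2 ≤ n) (hℓ : 1 ≤ ℓ) (r : Fin ℓ → ℕ) (hr : ∀ i, 1 ≤ r i) :
    (∃ U : Set (Fin n → ℂ), IsOpen[PeriodicMultipliers.zariskiTopology n] U ∧
      PeriodicMultipliers.Z0 n ℓ r = PeriodicMultipliers.Z n ℓ r ∩ U) ∧
    IsOpen[PeriodicMultipliers.zariskiTopology n] (PeriodicMultipliers.Z0 n ℓ r) := by
  have h := PeriodicMultipliers.isOpen_Z0 hn hr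
  exact ⟨⟨_, h, (Set.inter_eq_right.2 fun a ha => ha.1).symm⟩, h⟩
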